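/- Theorem 2.3. Conventions. Functions take values in $[0,\infty]$, $0\cdot\infty=0$, $m$ is Lebesgue measure on $(0,\infty)$ and $L^+$, $L^+_\nu$ are the non-negative measurable functions on $(0,\infty)$ (with respect to $m$) and on a measure space with measure $\nu$. For a measure $\mu$ on $Y$ and measurable $f:Y\to[0,\infty]$ put $\mu_f(t)=\mu\{y\in Y: f(y)>t\}$ for $t>0$, and $f^*(x)=\sup\{t>0: x<\mu_f(t)\}$ for $x>0$ ($\sup\emptyset=0$). If $(S,\Sigma,\lambda)$ and $(Y,\mu)$ are $\sigma$-finite, a map $B:Y\to\Sigma$ is a core map if its range is totally ordered by inclusion, $y\mapsto\lambda(E\cap B(y))$ is $\mu$-measurable for every $E\in\Sigma$, $\bigcup_{y\in Y}B(y)=\bigcup_{y\in Y_0}B(y)$ for some countable $Y_0\subseteq Y$, and $\lambda(B(y))<\infty$ for all $y$. For such $B$, a function $b:(0,\infty)\to[0,\infty]$ is the normal form parameter of the Hardy inequality $$\Big(\int_Y\Big(\int_{B(y)}g\,d\lambda\Big)^q d\mu(y)\Big)^{1/q}\le C\Big(\int_S g^p\,d\lambda\Big)^{1/p},\quad g\in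 L^+_\lambda,$$ if $b$ is non-increasing and $b=(\lambda\circ B)^*$ almost everywhere on $(0,\infty)$, the rearrangement being taken with respect to $\mu$. Statement. Let $1<p<\infty$ and $0<q<\infty$. Let $\lambda,\mu$ be Borel measures on $\mathbb R$ such that $\lambda(-\infty,s]<\infty$ for all $s\in\mathbb R$ and $\mu[y,\infty)<\infty$ for all $y\in\mathbb R$. Suppose $M:\mathbb R\to[0,\infty]$ satisfies $\mu(y,\infty)\le M(y)\le\mu[y,\infty)$ for all $y\in\mathbb R$, and let $M^{-1}(x)=\sup\{y\in\mathbb R: x<M(y)\}\in[-\infty,\infty]$ for $x>0$, with $\sup\emptyset=-\infty$. Let $\Lambda^-(s)=\lambda(-\infty,s)$ and $\Lambda^+(s)=\lambda(-\infty,s]$ for $s\in\mathbb R$, and $\Lambda^\pm(-\infty)=0$. (a) The map $y\mapsto(-\infty,y)$ is a core map, and $b=\Lambda^-\circ M^{-1}$ is the normal form parameter of the Hardy inequality $$\Big(\int_{\mathbb R}\Big(\int_{(-\infty,y)}g\,d\lambda\Big)^q d\mu(y)\Big)^{1/q}\le C\Big(\int_{\mathbb R}g^p\,d\lambda\Big)^{1/p},\quad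 g\in L^+_\lambda.$$ For every $C\in[0,\infty]$ this inequality holds if and only if $$\Big(\int_0^\infty\Big(\int_0^{b(x)}f(t)\,dt\Big)^q dx\Big)^{1/q}\le C\Big(\int_0^\infty f(t)^p\,dt\Big)^{1/p},\quad f\in L^+;$$ in particular, the best constants (finite or infinite) in the two inequalities are equal. (b) The map $y\mapsto(-\infty,y]$ is a core map, and $b=\Lambda^+\circ M^{-1}$ is the normal form parameter of the Hardy inequality $$\Big(\int_{\mathbb R}\Big(\int_{(-\infty,y]}g\,d\lambda\Big)^q d\mu(y)\Big)^{1/q}\le C\Big(\int_{\mathbb R}g^p\,d\lambda\Big)^{1/p},\quad g\in L^+_\lambda.$$ For every $C\in[0,\infty]$ this inequality holds if and only if the second inequality displayed in (a) holds with this $b$; in particular, the best constants (finite or infinite) in the two inequalities are equal. -/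

import Mathlib

open MeasureTheory Set
open scoped ENNReal

noncomputable section

/-! A function on `(0,∞)` with values in `[0,∞]` is represented by a function `ℝ → ℝ≥0∞`;
only its values on `Ioi 0` are ever used. `AEMeasurable g ν` says that `g` is measurable
with respect to the `ν`-completion of the underlying σ-algebra. -/

/-- The abstract Hardy operator `K_B g (y) = ∫_{B(y)} g dν`. -/
def abstractHardyOp {S Y : Type*} [MeasurableSpace S] (ν : Measure S) (B : Y → Set S)
    (g : S → ℝ≥0∞) (y : Y) : ℝ≥0∞ :=
  ∫⁻ s in B y, g s ∂ν

/-- The abstract Hardy inequality with indices `p`, `q` and constant `C`. -/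
def AbstractHardyIneq {S Y : Type*} [MeasurableSpace S] [MeasurableSpace Y]
    (ν : Measure S) (μ : Measure Y) (B : Y → Set S) (p q : ℝ) (C : ℝ≥0∞) : Prop :=
  ∀ g : S → ℝ≥0∞, AEMeasurable g ν →
    (∫⁻ y, (abstractHardyOp ν B g y) ^ q ∂μ) ^ (1 / q) ≤ C * (∫⁻ s, (g s) ^ p ∂ν) ^ (1 / p)

/-- The operator norm of `K_B : L^p_ν → L^q_μ` (`∞` if unbounded). -/
def abstractHardyNorm {S Y : Type*} [MeasurableSpace S] [MeasurableSpace Y]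
    (ν : Measure S) (μ : Measure Y) (B : Y → Set S) (p q : ℝ) : ℝ≥0∞ :=
  sInf {C : ℝ≥0∞ | AbstractHardyIneq ν μ B p q C}

/-- Core maps from a σ-finite measure space `(Y, μ)` to the measurable sets of a σ-finite
measure space `(S, ν)`. -/
structure IsCoreMap {S Y : Type*} [MeasurableSpace S] [MeasurableSpace Y]
    (ν : Measure S) (μ : Measure Y) (B : Y → Set S) : Prop where
  sigmaFinite_dom : SigmaFinite ν
  sigmaFinite_cod : SigmaFinite μ
  measurableSet : ∀ y, MeasurableSet (B y)
  total : ∀ y z, B y ⊆ B z ∨ B z ⊆ B y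
  aemeasurable : ∀ E : Set S, MeasurableSet E → AEMeasurable (fun y => ν (E ∩ B y)) μ
  sigmaBounded : ∃ Y₀ : Set Y, Y₀.Countable ∧ ⋃ y, B y = ⋃ y ∈ Y₀, B y
  finite : ∀ y, ν (B y) < ∞

/-- The normal form Hardy operator `H_b f (x) = ∫_0^{b(x)} f(t) dt`. -/
def normalFormOp (b f : ℝ → ℝ≥0∞) (x : ℝ) : ℝ≥0∞ :=
  ∫⁻ t in {t : ℝ | 0 < t ∧ ENNReal.ofReal t < b x}, f t

/-- The normal form Hardy inequality with parameter `b`, indices `p`, `q` and constant `C`. -/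
def NormalFormIneq (b : ℝ → ℝ≥0∞) (p q : ℝ) (C : ℝ≥0∞) : Prop :=
  ∀ f : ℝ → ℝ≥0∞, AEMeasurable f (volume.restrict (Ioi 0)) →
    (∫⁻ x in Ioi (0 : ℝ), (normalFormOp b f x) ^ q) ^ (1 / q)
      ≤ C * (∫⁻ t in Ioi (0 : ℝ), (f t) ^ p) ^ (1 / p)

/-- The operator norm `N_{p,q}(b)` of `H_b : L^p → L^q` (`∞` if unbounded). -/
def normalFormNorm (b : ℝ → ℝ≥0∞) (p q : ℝ) : ℝ≥0∞ :=
  sInf {C : ℝ≥0∞ | NormalFormIneq b p q C}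

/-- The generalized inverse `b⁻¹(y) = sup {x > 0 : y < b(x)}`, with `sup ∅ = 0`, of a function
`b : (0,∞) → [0,∞]`, for `y > 0`. -/
def genInverse (b : ℝ → ℝ≥0∞) (y : ℝ) : ℝ≥0∞ :=
  sSup (ENNReal.ofReal '' {x : ℝ | 0 < x ∧ ENNReal.ofReal y < b x})

/-- The distribution function `μ_f(t) = μ {y : f(y) > t}`, for `t > 0`, of `f ≥ 0`. -/
def distribution {Y : Type*} [MeasurableSpace Y] (μ : Measure Y) (f : Y → ℝ≥0∞)
    (t : ℝ) : ℝ≥0∞ :=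
  μ {y | ENNReal.ofReal t < f y}

/-- The non-increasing rearrangement `f^*` of `f ≥ 0` with respect to `μ`. -/
def rearrangement {Y : Type*} [MeasurableSpace Y] (μ : Measure Y) (f : Y → ℝ≥0∞) :
    ℝ → ℝ≥0∞ :=
  genInverse (distribution μ f)

/-- `b` is the normal form parameter of the abstract Hardy inequality given by the core map `B`:
a non-increasing function on `(0,∞)` that agrees with `(ν ∘ B)^*` almost everywhere. (Normal form
parameters are identified when they agree almost everywhere.) -/
structure IsNormalFormParameter {S Y : Type*} [MeasurableSpace S] [MeasurableSpace Y]
    (ν : Measure S) (μ : Measure Y) (B : Y → Set S) (b : ℝ → ℝ≥0∞) : Prop where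
  isCoreMap : IsCoreMap ν μ B
  antitoneOn : AntitoneOn b (Ioi 0)
  ae_eq : b =ᵐ[volume.restrict (Ioi 0)] rearrangement μ (fun y => ν (B y))

/-- `M⁻¹(x) = sup {y ∈ ℝ : x < M(y)}` for `M` on the whole line; the supremum is taken in
`[-∞,∞]`, so it is `-∞` when the set is empty. -/
def lineInverse (M : ℝ → ℝ≥0∞) (x : ℝ) : EReal :=
  sSup ((fun y : ℝ => (y : EReal)) '' {y : ℝ | ENNReal.ofReal x < M y})

/-- `Λ⁻(s) = ν(-∞, s)` for `s ∈ [-∞,∞]`. -/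
def cumulLt (ν : Measure ℝ) (s : EReal) : ℝ≥0∞ := ν {t : ℝ | (t : EReal) < s}

/-- `Λ⁺(s) = ν(-∞, s]` for `s ∈ [-∞,∞]`. -/
def cumulLe (ν : Measure ℝ) (s : EReal) : ℝ≥0∞ := ν {t : ℝ | (t : EReal) ≤ s}

theorem cumulLt_coe (ν : Measure ℝ) (s : ℝ) : cumulLt ν (s : EReal) = ν (Iio s) := by
  simp [cumulLt, Iio]

theorem cumulLe_coe (ν : Measure ℝ) (s : ℝ) : cumulLe ν (s : EReal) = ν (Iic s) := by
  simp [cumulLe, Iic]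

theorem cumulLt_bot (ν : Measure ℝ) : cumulLt ν ⊥ = 0 := by simp [cumulLt]

theorem cumulLe_bot (ν : Measure ℝ) : cumulLe ν ⊥ = 0 := by simp [cumulLe]

end

/-! Two independent facts carry the theorem. The first identifies `b`: since `M y` lies between the
measures of the open and closed right rays at `y`, `Λ^± ∘ M⁻¹` and the rearrangement of `y ↦ λ(B y)`
can differ only at jumps, hence only on a countable set (`ae_eq_rearrangement`,
`cumulLt_lineInverse_ae_eq`, `cumulLe_lineInverse_ae_eq`).

The second transports the inequality to the half-line. The quantile function `φ` of `λ` pushes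
Lebesgue measure on an initial interval `T` of `(0,∞)` to `λ` (`exists_monotoneOn_map_volume_eq`).
As `φ` is monotone and `B y` is a lower set, `φ⁻¹(B y) ∩ T` is, up to a null set, the interval `(0,
λ(B y))`. Thus the inner integral depends on `y` only through `λ(B y)`, and equimeasurability
replaces `μ` by Lebesgue measure and `λ(B y)` by `b` (`lintegral_comp_eq_of_ae_eq_rearrangement`).

Test functions pass both ways: `g` becomes `g ∘ φ` extended by zero, with the same norm; `f` is
averaged over the fibres of `φ`, which keeps its integrals over the sets `φ⁻¹(B)` and does not
increase its `L^p` norm (`exists_lintegral_rpow_le_of_map`). Hence the constants `C` are the same.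
-/

/-! ### Continuity of measures along rays. -/

/-- Without a least element, `U` is a directed countable union of open rays with rational endpoints
in `U`, so continuity from below applies. -/
theorem exists_lt_measure_Ioi_of_isUpperSet {μ : Measure ℝ} {U : Set ℝ} (hU : IsUpperSet U)
    (hmin : ∀ y ∈ U, ∃ z ∈ U, z < y) {c : ℝ≥0∞} (hc : c < μ U) :
    ∃ y ∈ U, c < μ (Ioi y) := by
  have hUnion : U = ⋃ q : {q : ℚ // (q : ℝ) ∈ U}, Ioi (q.1 : ℝ) := by
    ext y
    simp only [mem_iUnion, mem_Ioi, Subtype.exists, exists_prop]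
    constructor
    · intro hy
      obtain ⟨z, hz, hzy⟩ := hmin y hy
      obtain ⟨q, hq1, hq2⟩ := exists_rat_btwn hzy
      exact ⟨q, hU hq1.le hz, hq2⟩
    · rintro ⟨q, hq, hqy⟩
      exact hU hqy.le hq
  have hdir : Directed (· ⊆ ·) fun q : {q : ℚ // (q : ℝ) ∈ U} => Ioi (q.1 : ℝ) := by
    intro a b
    rcases le_total a b with h | h
    · exact ⟨a, subset_rfl, Ioi_subset_Ioi (by exact_mod_cast h)⟩
    · exact ⟨b, Ioi_subset_Ioi (by exact_mod_cast h), subset_rfl⟩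
  rw [hUnion, hdir.measure_iUnion, lt_iSup_iff] at hc
  obtain ⟨q, hq⟩ := hc
  exact ⟨q.1, q.2, hq⟩

theorem exists_lt_measure_Iio_of_isLowerSet {μ : Measure ℝ} {L : Set ℝ} (hL : IsLowerSet L)
    (hmax : ∀ y ∈ L, ∃ z ∈ L, y < z) {c : ℝ≥0∞} (hc : c < μ L) :
    ∃ y ∈ L, c < μ (Iio y) := by
  have hUnion : L = ⋃ q : {q : ℚ // (q : ℝ) ∈ L}, Iio (q.1 : ℝ) := by
    ext y
    simp only [mem_iUnion, mem_Iio, Subtype.exists, exists_prop]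
    constructor
    · intro hy
      obtain ⟨z, hz, hzy⟩ := hmax y hy
      obtain ⟨q, hq1, hq2⟩ := exists_rat_btwn hzy
      exact ⟨q, hL hq2.le hz, hq1⟩
    · rintro ⟨q, hq, hqy⟩
      exact hL hqy.le hq
  have hdir : Directed (· ⊆ ·) fun q : {q : ℚ // (q : ℝ) ∈ L} => Iio (q.1 : ℝ) := by
    intro a b
    rcases le_total a b with h | h
    · exact ⟨b, Iio_subset_Iio (by exact_mod_cast h), subset_rfl⟩
    · exact ⟨a, subset_rfl, Iio_subset_Iio (by exact_mod_cast h)⟩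
  rw [hUnion, hdir.measure_iUnion, lt_iSup_iff] at hc
  obtain ⟨q, hq⟩ := hc
  exact ⟨q.1, q.2, hq⟩

theorem le_measure_Iic_of_forall_gt {ν : Measure ℝ} (hν : ∀ s : ℝ, ν (Iic s) < ∞) {s : ℝ}
    {c : ℝ≥0∞} (h : ∀ y, s < y → c ≤ ν (Iic y)) : c ≤ ν (Iic s) := by
  have ht := tendsto_measure_biInter_gt (μ := ν) (s := fun y : ℝ => Iic y) (a := s)
    (fun r _ => measurableSet_Iic.nullMeasurableSet) (fun i j _ hij => Iic_subset_Iic.2 hij)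
    ⟨s + 1, by simp, (hν _).ne⟩
  have hI : (⋂ r > s, Iic r) = Iic s := by
    ext x
    simp only [mem_iInter, mem_Iic]
    exact ⟨fun H => le_of_forall_gt_imp_ge_of_dense H, fun H r hr => H.trans hr.le⟩
  rw [hI] at ht
  refine ge_of_tendsto ht ?_
  filter_upwards [self_mem_nhdsWithin] with y hy using h y hy

/-- Reflection of `le_measure_Iic_of_forall_gt` under `y ↦ -y`. -/
theorem le_measure_Ici_of_forall_lt {μ : Measure ℝ} (hμ : ∀ y : ℝ, μ (Ici y) < ∞) {s : ℝ}
    {c : ℝ≥0∞} (h : ∀ y, y < s → c ≤ μ (Ici y)) : c ≤ μ (Ici s) := by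
  have hmap : ∀ y : ℝ, (μ.map Neg.neg) (Iic y) = μ (Ici (-y)) := by
    intro y
    rw [Measure.map_apply measurable_neg measurableSet_Iic]
    congr 1
    ext x
    simp
  have := le_measure_Iic_of_forall_gt (ν := μ.map Neg.neg) (s := -s) (c := c)
    (fun y => by rw [hmap]; exact hμ _) (fun y hy => by rw [hmap]; exact h _ (by linarith))
  simpa [hmap] using this

theorem exists_measure_Iic_lt {ν : Measure ℝ} (hν : ∀ s : ℝ, ν (Iic s) < ∞) {c : ℝ≥0∞}
    (hc : 0 < c) : ∃ y : ℝ, ν (Iic y) < c := by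
  have ht := tendsto_measure_iInter_atBot (μ := ν) (s := fun y : ℝ => Iic y)
    (fun r => measurableSet_Iic.nullMeasurableSet) (fun i j hij => Iic_subset_Iic.2 hij)
    ⟨0, (hν _).ne⟩
  have hI : (⋂ r : ℝ, Iic r) = ∅ := iInter_Iic_eq_empty_iff.2 (by
    rintro ⟨x, hx⟩
    have := hx ⟨x - 1, rfl⟩
    linarith)
  rw [hI, measure_empty] at ht
  exact (ht.eventually (gt_mem_nhds hc)).exists

/-! ### Generalized inverses and the rearrangement. -/

theorem antitone_lineInverse (M : ℝ → ℝ≥0∞) : Antitone (lineInverse M) := by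
  intro x x' h
  refine sSup_le_sSup (image_mono fun y hy => ?_)
  exact lt_of_le_of_lt (ENNReal.ofReal_le_ofReal h) hy

theorem monotone_cumulLt (ν : Measure ℝ) : Monotone (cumulLt ν) :=
  fun _ _ h => measure_mono fun _ ht => lt_of_lt_of_le ht h

theorem monotone_cumulLe (ν : Measure ℝ) : Monotone (cumulLe ν) :=
  fun _ _ h => measure_mono fun _ ht => le_trans ht h

theorem coe_le_lineInverse {M : ℝ → ℝ≥0∞} {x y : ℝ} (h : ENNReal.ofReal x < M y) :
    (y : EReal) ≤ lineInverse M x :=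
  le_sSup ⟨y, h, rfl⟩

theorem exists_of_lt_lineInverse {M : ℝ → ℝ≥0∞} {x : ℝ} {s : EReal} (h : s < lineInverse M x) :
    ∃ y : ℝ, s < y ∧ ENNReal.ofReal x < M y := by
  obtain ⟨_, ⟨y, hy, rfl⟩, hsy⟩ := lt_sSup_iff.1 h
  exact ⟨y, hsy, hy⟩

theorem antitone_genInverse (b : ℝ → ℝ≥0∞) : Antitone (genInverse b) := by
  intro x x' h
  refine sSup_le_sSup (image_mono fun y hy => ⟨hy.1, ?_⟩)
  exact lt_of_le_of_lt (ENNReal.ofReal_le_ofReal h) hy.2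

/-- A nonincreasing function is a.e. equal to a rearrangement as soon as it is compatible with the
distribution function up to a jump. -/
theorem ae_eq_rearrangement {Y : Type*} [MeasurableSpace Y] {μ : Measure Y} {h : Y → ℝ≥0∞}
    {b : ℝ → ℝ≥0∞}
    (h1 : ∀ x t : ℝ, 0 < x → 0 < t → ENNReal.ofReal x < distribution μ h t →
      ENNReal.ofReal t < b x)
    (h2 : ∀ x' x t : ℝ, 0 < x' → x' < x → 0 < t → ENNReal.ofReal t < b x →
      ENNReal.ofReal x' < distribution μ h t) :
    b =ᵐ[volume.restrict (Ioi 0)] rearrangement μ h := by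
  have hle : ∀ x, 0 < x → rearrangement μ h x ≤ b x := by
    intro x hx
    refine sSup_le ?_
    rintro _ ⟨t, ⟨ht, hxt⟩, rfl⟩
    exact (h1 x t hx ht hxt).le
  have hge : ∀ x' x, 0 < x' → x' < x → b x ≤ rearrangement μ h x' := by
    intro x' x hx' hx
    refine le_of_forall_lt fun c hc => ?_
    obtain ⟨r, hr1, hr2⟩ := ENNReal.lt_iff_exists_nnreal_btwn.1 hc
    have hr0 : (0 : ℝ) < r := by
      exact_mod_cast pos_of_gt hr1
    refine lt_of_lt_of_le hr1 (le_sSup ⟨r, ⟨hr0, h2 x' x r hx' hx hr0 ?_⟩, by simp⟩)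
    simpa using hr2
  -- `b x` is squeezed between the rearrangement at `x` and at every `x' < x`, so equality holds
  -- wherever the monotone rearrangement is continuous.
  have hcount := (antitone_genInverse (distribution μ h)).countable_not_continuousAt
  have hae := (hcount.ae_notMem volume)
  filter_upwards [ae_restrict_of_ae hae, ae_restrict_mem measurableSet_Ioi] with x hx hx0
  have hx0' : 0 < x := hx0
  refine le_antisymm ?_ (hle x hx0)
  have hcont : ContinuousAt (rearrangement μ h) x := by
    simpa [rearrangement] using hx
  refine ge_of_tendsto (hcont.tendsto.mono_left nhdsWithin_le_nhds : Filter.Tendsto _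
    (nhdsWithin x (Iio x)) _) ?_
  filter_upwards [Ioo_mem_nhdsLT hx0'] with y hy using hge y x hy.1 hy.2

section LineInverse

variable {lam μ : Measure ℝ} {M : ℝ → ℝ≥0∞}

/-- Left-continuity of `Λ⁻` leaves its strict superlevel sets without a least element, and `{r | r <
M⁻¹(x)}` has no greatest element; continuity from below therefore handles both directions. -/
theorem cumulLt_lineInverse_ae_eq (hM : ∀ y : ℝ, μ (Ioi y) ≤ M y ∧ M y ≤ μ (Ici y)) :
    (fun x => cumulLt lam (lineInverse M x)) =ᵐ[volume.restrict (Ioi 0)]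
      rearrangement μ (fun y => lam (Iio y)) := by
  refine ae_eq_rearrangement ?_ ?_
  · intro x t _ _ hxt
    obtain ⟨y, hy, hxy⟩ := exists_lt_measure_Ioi_of_isUpperSet
      (U := {y | ENNReal.ofReal t < lam (Iio y)})
      (fun y z hyz hy => lt_of_lt_of_le hy (measure_mono (Iio_subset_Iio hyz)))
      (fun y hy => by
        obtain ⟨z, hz, htz⟩ := exists_lt_measure_Iio_of_isLowerSet (isLowerSet_Iio y)
          (fun a ha => (exists_between ha).imp fun b hb => ⟨hb.2, hb.1⟩) hy
        exact ⟨z, htz, hz⟩) hxt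
    refine lt_of_lt_of_le hy ?_
    rw [← cumulLt_coe]
    exact monotone_cumulLt _ (coe_le_lineInverse (hxy.trans_le (hM y).1))
  · intro x' x t hx' hx _ ht
    obtain ⟨y, hy, hty⟩ := exists_lt_measure_Iio_of_isLowerSet
      (L := {r : ℝ | (r : EReal) < lineInverse M x})
      (fun a b hba ha => lt_of_le_of_lt (EReal.coe_le_coe_iff.2 hba) ha)
      (fun a ha => by
        obtain ⟨r, hr1, hr2⟩ := EReal.exists_between_coe_real ha
        exact ⟨r, hr2, EReal.coe_lt_coe_iff.1 hr1⟩) ht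
    obtain ⟨y', hyy', hxy'⟩ := exists_of_lt_lineInverse hy
    refine lt_of_le_of_lt (ENNReal.ofReal_le_ofReal hx.le)
      (lt_of_lt_of_le (hxy'.trans_le (hM y').2) (measure_mono fun z hz => ?_))
    refine lt_of_lt_of_le hty (measure_mono (Iio_subset_Iio ?_))
    exact (EReal.coe_lt_coe_iff.1 hyy').le.trans hz

/-- Unlike for `Λ⁻`, endpoints now matter: a superlevel set of `Λ⁺` may be a closed ray, and
`Λ⁺(M⁻¹(x))` may count an atom at `M⁻¹(x)`. -/
theorem cumulLe_lineInverse_ae_eq (hμ : ∀ y : ℝ, μ (Ici y) < ∞)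
    (hM : ∀ y : ℝ, μ (Ioi y) ≤ M y ∧ M y ≤ μ (Ici y)) :
    (fun x => cumulLe lam (lineInverse M x)) =ᵐ[volume.restrict (Ioi 0)]
      rearrangement μ (fun y => lam (Iic y)) := by
  refine ae_eq_rearrangement ?_ ?_
  · intro x t _ _ hxt
    have hU : IsUpperSet {y | ENNReal.ofReal t < lam (Iic y)} :=
      fun y z hyz hy => lt_of_lt_of_le hy (measure_mono (Iic_subset_Iic.2 hyz))
    suffices H : ∃ y : ℝ, ENNReal.ofReal t < lam (Iic y) ∧ (y : EReal) ≤ lineInverse M x by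
      obtain ⟨y, hy, hys⟩ := H
      refine lt_of_lt_of_le hy ?_
      rw [← cumulLe_coe]
      exact monotone_cumulLe _ hys
    by_cases hmin : ∀ y ∈ {y | ENNReal.ofReal t < lam (Iic y)},
        ∃ z ∈ {y | ENNReal.ofReal t < lam (Iic y)}, z < y
    · obtain ⟨y, hy, hxy⟩ := exists_lt_measure_Ioi_of_isUpperSet hU hmin hxt
      exact ⟨y, hy, coe_le_lineInverse (hxy.trans_le (hM y).1)⟩
    -- With a least element `y`, the superlevel set lies in `[y,∞)`. Every `r < y` then has `x < μ
    -- (Ioi r) ≤ M r`, so `y ≤ M⁻¹(x)`.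
    · push Not at hmin
      obtain ⟨y, hy, hmin⟩ := hmin
      refine ⟨y, hy, le_of_forall_lt fun s hs => ?_⟩
      obtain ⟨r, hr1, hr2⟩ := EReal.exists_between_coe_real hs
      refine hr1.trans_le (coe_le_lineInverse ?_)
      refine lt_of_lt_of_le hxt (le_trans (measure_mono fun z hz => ?_) (hM r).1)
      exact (EReal.coe_lt_coe_iff.1 hr2).trans_le (hmin z hz)
  · intro x' x t hx' hx _ ht
    -- The gap between `x'` and `x` restores the strict inequality that is lost when `μ (Ici y)`
    -- passes to the limit.
    have hxx : ENNReal.ofReal x' < ENNReal.ofReal x :=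
      (ENNReal.ofReal_lt_ofReal_iff (hx'.trans hx)).2 hx
    have key : ∀ y : ℝ, (y : EReal) < lineInverse M x → ENNReal.ofReal x ≤ μ (Ici y) := by
      intro y hy
      obtain ⟨y', hyy', hxy'⟩ := exists_of_lt_lineInverse hy
      exact (hxy'.trans_le (hM y').2).le.trans
        (measure_mono (Ici_subset_Ici.2 (EReal.coe_lt_coe_iff.1 hyy').le))
    suffices H : ∃ y : ℝ, ENNReal.ofReal t < lam (Iic y) ∧ ENNReal.ofReal x ≤ μ (Ici y) by
      obtain ⟨y, hy, hxy⟩ := H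
      refine lt_of_lt_of_le (hxx.trans_le hxy) (measure_mono fun z hz => ?_)
      exact lt_of_lt_of_le hy (measure_mono (Iic_subset_Iic.2 hz))
    change ENNReal.ofReal t < cumulLe lam (lineInverse M x) at ht
    rcases eq_or_ne (lineInverse M x) ⊥ with hbot | hbot
    · simp [hbot, cumulLe_bot] at ht
    rcases eq_or_ne (lineInverse M x) ⊤ with htop | htop
    · have huniv : {r : ℝ | (r : EReal) ≤ ⊤} = univ := by simp
      rw [htop, cumulLe, huniv] at ht
      obtain ⟨y, -, hy⟩ := exists_lt_measure_Iio_of_isLowerSet isLowerSet_univ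
        (fun y _ => ⟨y + 1, mem_univ _, by linarith⟩) ht
      refine ⟨y, hy.trans_le (measure_mono Iio_subset_Iic_self), key y ?_⟩
      rw [htop]
      exact EReal.coe_lt_top y
    · lift lineInverse M x to ℝ using ⟨htop, hbot⟩ with s hs
      rw [cumulLe_coe] at ht
      exact ⟨s, ht, le_measure_Ici_of_forall_lt hμ fun y hy =>
        key y (EReal.coe_lt_coe_iff.2 hy)⟩

end LineInverse

/-! ### Quantile transport to the half-line. -/

/-- A locally finite measure on the line that is finite at `-∞` is the image of Lebesgue measure on
an initial interval of `(0,∞)` under a nondecreasing map. -/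
theorem exists_monotoneOn_map_volume_eq {ν : Measure ℝ} (hν : ∀ s : ℝ, ν (Iic s) < ∞) :
    ∃ (T : Set ℝ) (φ : ℝ → ℝ), MeasurableSet T ∧ T ⊆ Ioi 0 ∧
      (∀ t ∈ T, ∀ s, 0 < s → s ≤ t → s ∈ T) ∧ MonotoneOn φ T ∧ Measurable φ ∧
      Measure.map φ (volume.restrict T) = ν := by
  classical
  set T : Set ℝ := {t | 0 < t ∧ ENNReal.ofReal t < ν univ} with hT
  have hTm : MeasurableSet T := measurableSet_Ioi.inter
    (measurableSet_lt ENNReal.measurable_ofReal measurable_const)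
  set ψ : ℝ → ℝ := fun t => sInf {s : ℝ | ENNReal.ofReal t ≤ ν (Iic s)} with hψ
  -- Right-continuity of `s ↦ ν (Iic s)` yields this Galois connection. On `T` the infimum is over a
  -- nonempty set because `t < ν univ`, and one bounded below because `t > 0`.
  have hgal : ∀ t ∈ T, ∀ s, ψ t ≤ s ↔ ENNReal.ofReal t ≤ ν (Iic s) := by
    intro t ht s
    have hbdd : BddBelow {s : ℝ | ENNReal.ofReal t ≤ ν (Iic s)} := by
      obtain ⟨y, hy⟩ := exists_measure_Iic_lt hν (ENNReal.ofReal_pos.2 ht.1)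
      refine ⟨y, fun z hz => le_of_not_gt fun hzy => ?_⟩
      exact absurd (hz.trans (measure_mono (Iic_subset_Iic.2 hzy.le))) hy.not_ge
    have hne : {s : ℝ | ENNReal.ofReal t ≤ ν (Iic s)}.Nonempty := by
      obtain ⟨y, -, hy⟩ := exists_lt_measure_Iio_of_isLowerSet isLowerSet_univ
        (fun y _ => ⟨y + 1, mem_univ _, by linarith⟩) ht.2
      exact ⟨y, hy.le.trans (measure_mono Iio_subset_Iic_self)⟩
    refine ⟨fun h => le_measure_Iic_of_forall_gt hν fun y hy => ?_, fun h => csInf_le hbdd h⟩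
    obtain ⟨z, hz, hzy⟩ := exists_lt_of_csInf_lt hne (h.trans_lt hy)
    exact le_trans hz (measure_mono (Iic_subset_Iic.2 hzy.le))
  have hpre : ∀ s, T ∩ T.indicator ψ ⁻¹' Iic s = T ∩ {t | ENNReal.ofReal t ≤ ν (Iic s)} := by
    intro s
    ext t
    simp only [mem_inter_iff, mem_preimage, mem_Iic, mem_ofPred_eq, and_congr_right_iff]
    intro ht
    rw [indicator_of_mem ht, hgal t ht]
  have hφ : Measurable (T.indicator ψ) := by
    refine measurable_of_Iic fun s => ?_
    rw [← inter_union_compl (T.indicator ψ ⁻¹' Iic s) T, inter_comm, hpre]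
    refine (hTm.inter (measurableSet_le ENNReal.measurable_ofReal measurable_const)).union ?_
    -- Off `T` the indicator is `0`, so there the preimage of `Iic s` is all of `Tᶜ` or empty.
    by_cases hs : 0 ≤ s
    · convert hTm.compl using 1
      ext t
      by_cases ht : t ∈ T <;> simp [ht, hs]
    · convert MeasurableSet.empty using 1
      ext t
      by_cases ht : t ∈ T <;> simp [ht, hs]
  refine ⟨T, T.indicator ψ, hTm, fun t ht => ht.1, fun t ht s hs hst =>
    ⟨hs, (ENNReal.ofReal_le_ofReal hst).trans_lt ht.2⟩, ?_, hφ, ?_⟩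
  · intro t ht t' ht' htt
    rw [indicator_of_mem ht, indicator_of_mem ht', hgal t ht]
    exact (ENNReal.ofReal_le_ofReal htt).trans ((hgal t' ht' _).1 le_rfl)
  · have heq : ∀ s : ℝ, (Measure.map (T.indicator ψ) (volume.restrict T)) (Iic s) = ν (Iic s) := by
      intro s
      have hc := (hν s).ne
      rw [Measure.map_apply hφ measurableSet_Iic, Measure.restrict_apply (hφ measurableSet_Iic),
        inter_comm, hpre]
      apply le_antisymm
      · calc volume (T ∩ {t | ENNReal.ofReal t ≤ ν (Iic s)})
            ≤ volume (Ioc 0 (ν (Iic s)).toReal) :=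
              measure_mono fun t ht => ⟨ht.1.1, (ENNReal.ofReal_le_iff_le_toReal hc).1 ht.2⟩
          _ = ν (Iic s) := by simp [ENNReal.ofReal_toReal hc]
      · calc ν (Iic s) = volume (Ioo 0 (ν (Iic s)).toReal) := by
              simp [ENNReal.ofReal_toReal hc]
          _ ≤ _ := measure_mono fun t ht => by
              have := (ENNReal.ofReal_lt_iff_lt_toReal ht.1.le hc).2 ht.2
              exact ⟨⟨ht.1, this.trans_le (measure_mono (subset_univ _))⟩, this.le⟩
    refine Measure.ext_of_generateFrom_of_iUnion (range Iic) (fun n : ℕ => Iic (n : ℝ))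
      (BorelSpace.measurable_eq.trans (borel_eq_generateFrom_Iic ℝ)) isPiSystem_Iic
      ?_ (fun n => mem_range_self _) (fun n => by rw [heq]; exact (hν _).ne) ?_
    · exact iUnion_eq_univ_iff.2 fun x => exists_nat_ge x
    · rintro _ ⟨s, rfl⟩
      exact heq s

theorem ae_eq_setOf_ofReal_lt_volume {A : Set ℝ} (hA : A ⊆ Ioi 0)
    (hlow : ∀ t ∈ A, ∀ s, 0 < s → s ≤ t → s ∈ A) :
    A =ᵐ[volume] {t : ℝ | 0 < t ∧ ENNReal.ofReal t < volume A} := by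
  -- Only the right endpoint of `A` is ambiguous. If `volume A = ∞`, this discards `0`, which is
  -- harmless.
  have hne : ∀ᵐ t : ℝ, t ≠ (volume A).toReal :=
    (Set.countable_singleton (volume A).toReal).ae_notMem volume
  filter_upwards [hne] with t ht
  refine propext ⟨fun h => ⟨hA h, lt_of_le_of_ne ?_ ?_⟩, fun h => ?_⟩
  · calc ENNReal.ofReal t = volume (Ioc 0 t) := by simp
      _ ≤ volume A := measure_mono fun s hs => hlow t h s hs.1 hs.2
  · intro heq
    exact ht (by rw [← heq, ENNReal.toReal_ofReal (hA h).le])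
  · by_contra htA
    refine absurd h.2 (not_lt.2 ?_)
    calc volume A ≤ volume (Ioc 0 t) := measure_mono fun s hs =>
          ⟨hA hs, le_of_not_gt fun hts => htA (hlow s hs t h.1 hts.le)⟩
      _ = ENNReal.ofReal t := by simp

/-- Integrals over `φ⁻¹(B)`, for a lower set `B`, are normal form integrals. -/
theorem setLIntegral_preimage_eq {ν : Measure ℝ} {T : Set ℝ} {φ : ℝ → ℝ}
    (hT0 : T ⊆ Ioi 0)
    (hlow : ∀ t ∈ T, ∀ s, 0 < s → s ≤ t → s ∈ T) (hmono : MonotoneOn φ T) (hφ : Measurable φ)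
    (hmap : Measure.map φ (volume.restrict T) = ν) {B : Set ℝ} (hB : MeasurableSet B)
    (hBl : IsLowerSet B) (f : ℝ → ℝ≥0∞) :
    ∫⁻ t in φ ⁻¹' B, f t ∂(volume.restrict T) =
      ∫⁻ t in {t : ℝ | 0 < t ∧ ENNReal.ofReal t < ν B}, f t := by
  have hvol : volume (φ ⁻¹' B ∩ T) = ν B := by
    rw [← hmap, Measure.map_apply hφ hB, Measure.restrict_apply (hφ hB)]
  rw [Measure.restrict_restrict (hφ hB), ← hvol]
  refine setLIntegral_congr (ae_eq_setOf_ofReal_lt_volume (fun t ht => hT0 ht.2) ?_)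
  intro t ht s hs hst
  have hsT := hlow t ht.2 s hs hst
  exact ⟨hBl (hmono hsT ht.2 hst) ht.1, hsT⟩

/-! ### Equimeasurability. -/

theorem volume_setOf_ofReal_lt (v : ℝ≥0∞) : volume {x : ℝ | 0 < x ∧ ENNReal.ofReal x < v} = v := by
  rcases eq_or_ne v ∞ with rfl | hv
  · have : {x : ℝ | 0 < x ∧ ENNReal.ofReal x < ∞} = Ioi 0 := by ext; simp
    rw [this, Real.volume_Ioi]
  · have : {x : ℝ | 0 < x ∧ ENNReal.ofReal x < v} = Ioo 0 v.toReal := by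
      ext x
      exact and_congr_right fun hx => ENNReal.ofReal_lt_iff_lt_toReal hx.le hv
    rw [this, Real.volume_Ioo, sub_zero, ENNReal.ofReal_toReal hv]

theorem lt_rearrangement_iff {Y : Type*} [MeasurableSpace Y] {μ : Measure Y} {h : Y → ℝ≥0∞}
    {c : ℝ≥0∞} {x : ℝ} :
    c < rearrangement μ h x ↔ ENNReal.ofReal x < μ {y | c < h y} := by
  rw [rearrangement, genInverse, lt_sSup_iff]
  constructor
  · rintro ⟨_, ⟨t, ⟨-, hxt⟩, rfl⟩, hct⟩
    exact lt_of_lt_of_le hxt (measure_mono fun y hy => lt_trans hct hy)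
  · intro hx
    rcases eq_or_ne c ∞ with rfl | hc
    · simp at hx
    -- Approximating `c` from above gives admissible levels `t` that are positive, even for `c = 0`,
    -- and exceed `c` strictly.
    obtain ⟨u, hanti, hu0, hu⟩ := exists_seq_strictAnti_tendsto' (lt_top_iff_ne_top.2 hc)
    have hUnion : {y | c < h y} = ⋃ n, {y | u n < h y} := by
      ext y
      simp only [mem_ofPred_eq, mem_iUnion]
      refine ⟨fun hy => (hu.eventually (gt_mem_nhds hy)).exists, ?_⟩
      rintro ⟨n, hn⟩
      exact (hu0 n).1.trans hn
    have hmono : Monotone fun n => {y | u n < h y} :=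
      fun n m hnm y hy => lt_of_le_of_lt (hanti.antitone hnm) hy
    rw [hUnion, hmono.measure_iUnion, lt_iSup_iff] at hx
    obtain ⟨n, hn⟩ := hx
    have hun : ENNReal.ofReal (u n).toReal = u n := ENNReal.ofReal_toReal (hu0 n).2.ne
    refine ⟨u n, ⟨(u n).toReal, ⟨?_, ?_⟩, hun⟩, (hu0 n).1⟩
    · exact ENNReal.toReal_pos (pos_of_gt (hu0 n).1).ne' (hu0 n).2.ne
    · rwa [distribution, hun]

/-- Rearrangements preserve integrals of functions vanishing at zero. -/
theorem lintegral_comp_eq_of_ae_eq_rearrangement {Y : Type*} [MeasurableSpace Y] {μ : Measure Y}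
    {h : Y → ℝ≥0∞} (hh : Measurable h)
    (hfin : ∀ c : ℝ≥0∞, 0 < c → μ {y | c < h y} < ∞) {b : ℝ → ℝ≥0∞}
    (hb : b =ᵐ[volume.restrict (Ioi 0)] rearrangement μ h) {G : ℝ≥0∞ → ℝ≥0∞}
    (hG : Measurable G) (hG0 : G 0 = 0) :
    ∫⁻ y, G (h y) ∂μ = ∫⁻ x in Ioi (0 : ℝ), G (b x) := by
  set r := rearrangement μ h with hr
  have hrm : Measurable r := (antitone_genInverse _).measurable
  have hdist : ∀ c : ℝ≥0∞, volume.restrict (Ioi 0) {x | c < r x} = μ {y | c < h y} := by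
    intro c
    have hset : {x | c < r x} ∩ Ioi 0 = {x : ℝ | 0 < x ∧ ENNReal.ofReal x < μ {y | c < h y}} := by
      ext x
      exact and_comm.trans (and_congr_right fun _ => lt_rearrangement_iff)
    rw [Measure.restrict_apply (measurableSet_lt measurable_const hrm), hset,
      volume_setOf_ofReal_lt]
  -- The masses at `0` need not agree, but `G 0 = 0` makes them irrelevant. Away from `0` the rays
  -- `(u n, ∞]` have finite mass, which allows the π-system argument.
  have hmeas : (Measure.map h μ).restrict (Ioi 0) =
      (Measure.map r (volume.restrict (Ioi 0))).restrict (Ioi 0) := by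
    have key : ∀ c : ℝ≥0∞, Measure.map h μ (Ioi c) =
        Measure.map r (volume.restrict (Ioi 0)) (Ioi c) := by
      intro c
      rw [Measure.map_apply hh measurableSet_Ioi, Measure.map_apply hrm measurableSet_Ioi]
      exact (hdist c).symm
    have key' : ∀ c : ℝ≥0∞, (Measure.map h μ).restrict (Ioi 0) (Ioi c) =
        (Measure.map r (volume.restrict (Ioi 0))).restrict (Ioi 0) (Ioi c) := by
      intro c
      rw [Measure.restrict_apply measurableSet_Ioi, Measure.restrict_apply measurableSet_Ioi,
        Ioi_inter_Ioi, key]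
    obtain ⟨u, -, hu0, hu⟩ := exists_seq_strictAnti_tendsto' (α := ℝ≥0∞) (x := 0) (y := 1) (by simp)
    refine Measure.ext_of_generateFrom_of_cover (S := range Ioi)
      (T := insert {0} (range fun n => Ioi (u n)))
      (BorelSpace.measurable_eq.trans (borel_eq_generateFrom_Ioi ℝ≥0∞))
      ((countable_range _).insert _) isPiSystem_Ioi ?_ ?_ ?_ ?_
    · refine eq_univ_of_forall fun x => ?_
      rcases eq_or_ne x 0 with rfl | hx
      · exact ⟨{0}, mem_insert _ _, rfl⟩
      · obtain ⟨n, hn⟩ := (hu.eventually (gt_mem_nhds (pos_iff_ne_zero.2 hx))).exists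
        exact ⟨Ioi (u n), mem_insert_of_mem _ ⟨n, rfl⟩, hn⟩
    · rintro t (rfl | ⟨n, rfl⟩)
      · simp [Measure.restrict_apply]
      · refine ((Measure.restrict_apply_le _ _).trans_lt ?_).ne
        rw [Measure.map_apply hh measurableSet_Ioi]
        exact hfin _ (hu0 n).1
    · rintro t (rfl | ⟨n, rfl⟩) _ ⟨c, rfl⟩
      · have : Ioi c ∩ {(0 : ℝ≥0∞)} = ∅ := by ext; simp +contextual
        simp [this]
      · rw [Ioi_inter_Ioi, key']
    · rintro t (rfl | ⟨n, rfl⟩)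
      · simp [Measure.restrict_apply]
      · exact key' _
  have hind : (Ioi 0).indicator G = G := by
    ext x
    rcases eq_or_ne x 0 with rfl | hx
    · simp [hG0]
    · simp [pos_iff_ne_zero, hx]
  calc ∫⁻ y, G (h y) ∂μ = ∫⁻ u, G u ∂(Measure.map h μ) := (lintegral_map hG hh).symm
    _ = ∫⁻ u in Ioi 0, G u ∂(Measure.map h μ) := by
        rw [← lintegral_indicator measurableSet_Ioi, hind]
    _ = ∫⁻ u, G u ∂(Measure.map r (volume.restrict (Ioi 0))) := by
        rw [hmeas, ← lintegral_indicator measurableSet_Ioi, hind]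
    _ = ∫⁻ x in Ioi (0 : ℝ), G (r x) := lintegral_map hG hrm
    _ = ∫⁻ x in Ioi (0 : ℝ), G (b x) := lintegral_congr_ae (by
        filter_upwards [hb] with x hx
        rw [hx])

/-! ### Averaging over fibres contracts `L^p`. -/

/-- Finiteness permits cancelling the power `1 - 1/p`; this closes the Hölder argument for the
truncations below. -/
theorem lintegral_rpow_le_of_lintegral_mul_le {S : Type*} [MeasurableSpace S] {ν : Measure S}
    {p : ℝ} (hp : 1 < p) {k : S → ℝ≥0∞} (hfin : ∫⁻ s, k s ^ p ∂ν ≠ ∞) {A : ℝ≥0∞}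
    (h : ∫⁻ s, k s ^ p ∂ν ≤ A ^ (1 / p) * (∫⁻ s, k s ^ p ∂ν) ^ (1 - 1 / p)) :
    ∫⁻ s, k s ^ p ∂ν ≤ A := by
  set I := ∫⁻ s, k s ^ p ∂ν
  have hp0 : 0 < p := by linarith
  rcases eq_or_ne I 0 with h0 | h0
  · rw [h0]; exact zero_le
  have hsplit : I = I ^ (1 / p) * I ^ (1 - 1 / p) := by
    rw [← ENNReal.rpow_add _ _ h0 hfin]
    simp
  have hle : I ^ (1 / p) ≤ A ^ (1 / p) := by
    refine (ENNReal.mul_le_mul_iff_left (c := I ^ (1 - 1 / p)) ?_ ?_).1 (hsplit ▸ h)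
    · exact (ENNReal.rpow_pos (pos_iff_ne_zero.2 h0) hfin).ne'
    · refine ENNReal.rpow_ne_top_of_nonneg ?_ hfin
      rw [sub_nonneg, div_le_one hp0]
      exact hp.le
  exact (ENNReal.rpow_le_rpow_iff (by positivity)).1 hle

/-- The Radon–Nikodym derivative of the image of `f m` under `φ`, taken with respect to the image of
`m`, has smaller `L^p` norm than `f`. -/
theorem exists_lintegral_rpow_le_of_map {X S : Type*} [MeasurableSpace X] [MeasurableSpace S]
    {m : Measure X} [SFinite m] {ν : Measure S} [SigmaFinite ν] {φ : X → S} (hφ : Measurable φ)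
    (hmap : Measure.map φ m = ν) {p : ℝ} (hp : 1 < p) {f : X → ℝ≥0∞} (hf : Measurable f) :
    ∃ g : S → ℝ≥0∞, Measurable g ∧
      (∀ B, MeasurableSet B → ∫⁻ s in B, g s ∂ν = ∫⁻ t in φ ⁻¹' B, f t ∂m) ∧
      ∫⁻ s, g s ^ p ∂ν ≤ ∫⁻ t, f t ^ p ∂m := by
  have hp0 : 0 < p := by linarith
  set κ : Measure S := Measure.map φ (m.withDensity f) with hκ
  have hac : κ ≪ ν := hmap ▸ (withDensity_absolutelyContinuous m f).map hφ
  have hκg : ν.withDensity (κ.rnDeriv ν) = κ := Measure.withDensity_rnDeriv_eq κ ν hac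
  set g := κ.rnDeriv ν with hg
  have hgm : Measurable g := Measure.measurable_rnDeriv κ ν
  refine ⟨g, hgm, fun B hB => ?_, ?_⟩
  · rw [← withDensity_apply _ hB, hκg, hκ, Measure.map_apply hφ hB,
      withDensity_apply _ (hφ hB)]
  have hmul : ∀ k : S → ℝ≥0∞, Measurable k →
      ∫⁻ s, g s * k s ∂ν = ∫⁻ t, f t * k (φ t) ∂m := by
    intro k hk
    calc ∫⁻ s, g s * k s ∂ν = ∫⁻ s, k s ∂(ν.withDensity g) :=
          (lintegral_withDensity_eq_lintegral_mul ν hgm hk).symm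
      _ = ∫⁻ t, k (φ t) ∂(m.withDensity f) := by rw [hκg, hκ, lintegral_map hk hφ]
      _ = _ := lintegral_withDensity_eq_lintegral_mul m hf (hk.comp hφ)
  -- Truncating in height and in space makes `∫ k^p` finite; monotone convergence recovers `g`.
  set k : ℕ → S → ℝ≥0∞ :=
    fun n => (spanningSets ν n).indicator fun s => min (g s) n with hk
  have hkm : ∀ n, Measurable (k n) := fun n =>
    (hgm.min measurable_const).indicator (measurableSet_spanningSets ν n)
  have hkg : ∀ n s, k n s ≤ g s := fun n s =>
    (indicator_le_self _ _ s).trans (min_le_left _ _)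
  have hkmono : Monotone k := by
    intro n n' hnn s
    refine (indicator_le_indicator_of_subset (monotone_spanningSets ν hnn)
      (fun _ => zero_le) s).trans (indicator_le_indicator ?_)
    exact min_le_min le_rfl (by exact_mod_cast hnn)
  have hksup : ∀ s, ⨆ n, k n s = g s := by
    intro s
    refine le_antisymm (iSup_le fun n => hkg n s) (le_of_forall_lt fun c hc => ?_)
    obtain ⟨N, hN⟩ := ENNReal.exists_nat_gt hc.ne_top
    rw [lt_iSup_iff]
    refine ⟨max N (spanningSetsIndex ν s), ?_⟩
    have hmem : s ∈ spanningSets ν (max N (spanningSetsIndex ν s)) :=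
      monotone_spanningSets ν (le_max_right _ _) (mem_spanningSetsIndex ν s)
    rw [hk]
    simp only [indicator_of_mem hmem]
    exact lt_min hc (hN.trans_le (by exact_mod_cast le_max_left _ _))
  have hkfin : ∀ n, ∫⁻ s, k n s ^ p ∂ν ≠ ∞ := by
    intro n
    refine ne_top_of_le_ne_top
      (b := ∫⁻ s, (spanningSets ν n).indicator (fun _ => (n : ℝ≥0∞) ^ p) s ∂ν) ?_ ?_
    · rw [lintegral_indicator (measurableSet_spanningSets ν n), setLIntegral_const]
      exact ENNReal.mul_ne_top (ENNReal.rpow_ne_top_of_nonneg hp0.le (ENNReal.natCast_ne_top n))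
        (measure_spanningSets_lt_top ν n).ne
    · refine lintegral_mono fun s => ?_
      by_cases hs : s ∈ spanningSets ν n
      · simp only [hk, indicator_of_mem hs]
        exact ENNReal.rpow_le_rpow (min_le_right _ _) hp0.le
      · simp [hk, hs, hp0]
  have hbound : ∀ n, ∫⁻ s, k n s ^ p ∂ν ≤ ∫⁻ t, f t ^ p ∂m := by
    intro n
    refine lintegral_rpow_le_of_lintegral_mul_le hp (hkfin n) ?_
    have hpq : p.HolderConjugate (p / (p - 1)) := Real.HolderConjugate.conjExponent hp
    have hp1 : p - 1 ≠ 0 := by linarith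
    -- Duality: pull the pairing of `g` with `k^(p-1)` back to `X`, where `g` becomes `f`, and apply
    -- Hölder there.
    calc ∫⁻ s, k n s ^ p ∂ν ≤ ∫⁻ s, g s * k n s ^ (p - 1) ∂ν := by
          refine lintegral_mono fun s => ?_
          calc k n s ^ p = k n s * k n s ^ (p - 1) := by
                nth_rewrite 2 [← ENNReal.rpow_one (k n s)]
                rw [← ENNReal.rpow_add_of_nonneg _ _ zero_le_one (by linarith), add_sub_cancel]
            _ ≤ _ := by gcongr; exact hkg n s
      _ = ∫⁻ t, f t * k n (φ t) ^ (p - 1) ∂m := hmul _ ((hkm n).pow_const _)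
      _ ≤ (∫⁻ t, f t ^ p ∂m) ^ (1 / p) *
          (∫⁻ t, (k n (φ t) ^ (p - 1)) ^ (p / (p - 1)) ∂m) ^ (1 / (p / (p - 1))) :=
        ENNReal.lintegral_mul_le_Lp_mul_Lq m hpq hf.aemeasurable
          (((hkm n).comp hφ).pow_const _).aemeasurable
      _ = _ := by
        have e1 : (p - 1) * (p / (p - 1)) = p := by field_simp
        have e2 : 1 / (p / (p - 1)) = 1 - 1 / p := by field_simp
        simp only [← ENNReal.rpow_mul, e1, e2]
        rw [← hmap, lintegral_map ((hkm n).pow_const p) hφ]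
  calc ∫⁻ s, g s ^ p ∂ν = ∫⁻ s, ⨆ n, k n s ^ p ∂ν := by
        refine lintegral_congr fun s => ?_
        rw [← hksup s]
        exact (ENNReal.orderIsoRpow p hp0).map_iSup _
    _ = ⨆ n, ∫⁻ s, k n s ^ p ∂ν :=
        lintegral_iSup (fun n => (hkm n).pow_const p)
          (fun n n' h s => ENNReal.rpow_le_rpow (hkmono h s) hp0.le)
    _ ≤ _ := iSup_le hbound

/-! ### Equivalence of the two inequalities. -/

theorem abstractHardyIneq_iff_of_measurable {S Y : Type*} [MeasurableSpace S] [MeasurableSpace Y]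
    {ν : Measure S} {μ : Measure Y} {B : Y → Set S} {p q : ℝ} {C : ℝ≥0∞} :
    AbstractHardyIneq ν μ B p q C ↔ ∀ g : S → ℝ≥0∞, Measurable g →
      (∫⁻ y, (∫⁻ s in B y, g s ∂ν) ^ q ∂μ) ^ (1 / q) ≤ C * (∫⁻ s, (g s) ^ p ∂ν) ^ (1 / p) := by
  refine ⟨fun H g hg => H g hg.aemeasurable, fun H g hg => ?_⟩
  have hae := hg.ae_eq_mk
  have h1 : ∀ y, abstractHardyOp ν B g y = ∫⁻ s in B y, hg.mk g s ∂ν := fun y =>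
    lintegral_congr_ae (ae_restrict_of_ae hae)
  have h2 : ∫⁻ s, (g s) ^ p ∂ν = ∫⁻ s, (hg.mk g s) ^ p ∂ν :=
    lintegral_congr_ae (hae.mono fun s hs => by simp only [hs])
  simp only [h1, h2]
  exact H _ hg.measurable_mk

theorem normalFormIneq_iff_of_measurable {b : ℝ → ℝ≥0∞} {p q : ℝ} {C : ℝ≥0∞} :
    NormalFormIneq b p q C ↔ ∀ f : ℝ → ℝ≥0∞, Measurable f →
      (∫⁻ x in Ioi (0 : ℝ), (normalFormOp b f x) ^ q) ^ (1 / q)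
        ≤ C * (∫⁻ t in Ioi (0 : ℝ), (f t) ^ p) ^ (1 / p) := by
  refine ⟨fun H f hf => H f hf.aemeasurable, fun H f hf => ?_⟩
  have hae := hf.ae_eq_mk
  have h1 : ∀ x, normalFormOp b f x = normalFormOp b (hf.mk f) x := fun x =>
    lintegral_congr_ae (ae_restrict_of_ae_restrict_of_subset (fun t ht => ht.1) hae)
  have h2 : ∫⁻ t in Ioi (0 : ℝ), (f t) ^ p = ∫⁻ t in Ioi (0 : ℝ), (hf.mk f t) ^ p :=
    lintegral_congr_ae (hae.mono fun s hs => by simp only [hs])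
  simp only [h1, h2]
  exact H _ hf.measurable_mk

theorem sigmaFinite_of_measure_Iic_lt_top {ν : Measure ℝ} (hν : ∀ s : ℝ, ν (Iic s) < ∞) :
    SigmaFinite ν :=
  ⟨⟨{ set := fun n : ℕ => Iic (n : ℝ)
      set_mem := fun _ => trivial
      finite := fun _ => hν _
      spanning := iUnion_eq_univ_iff.2 fun x => exists_nat_ge x }⟩⟩

theorem sigmaFinite_of_measure_Ici_lt_top {ν : Measure ℝ} (hν : ∀ s : ℝ, ν (Ici s) < ∞) :
    SigmaFinite ν :=
  ⟨⟨{ set := fun n : ℕ => Ici (-(n : ℝ))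
      set_mem := fun _ => trivial
      finite := fun _ => hν _
      spanning := iUnion_eq_univ_iff.2 fun x => by
        obtain ⟨n, hn⟩ := exists_nat_ge (-x)
        exact ⟨n, by simp only [mem_Ici]; linarith⟩ }⟩⟩

section Line

variable {lam μ : Measure ℝ} {B : ℝ → Set ℝ}

theorem isCoreMap_of_Iio_subset (hlam : ∀ s : ℝ, lam (Iic s) < ∞) (hμ : ∀ y : ℝ, μ (Ici y) < ∞)
    (hBm : ∀ y, MeasurableSet (B y)) (hmono : Monotone B)
    (hIio : ∀ y, Iio y ⊆ B y) (hIic : ∀ y, B y ⊆ Iic y) : IsCoreMap lam μ B where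
  sigmaFinite_dom := sigmaFinite_of_measure_Iic_lt_top hlam
  sigmaFinite_cod := sigmaFinite_of_measure_Ici_lt_top hμ
  measurableSet := hBm
  total y z := (le_total y z).imp (fun h => hmono h) fun h => hmono h
  aemeasurable E _ := by
    have : Monotone fun y => lam (E ∩ B y) :=
      fun y z h => measure_mono (inter_subset_inter_right _ (hmono h))
    exact this.measurable.aemeasurable
  sigmaBounded := by
    refine ⟨range ((↑) : ℕ → ℝ), countable_range _, subset_antisymm ?_ ?_⟩
    · intro x _
      obtain ⟨n, hn⟩ := exists_nat_gt x
      exact mem_biUnion (mem_range_self n) (hIio n hn)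
    · exact iUnion₂_subset fun y _ => subset_iUnion B y
  finite y := (measure_mono (hIic y)).trans_lt (hlam y)

theorem abstractHardyIneq_iff_normalFormIneq {p q : ℝ} (hp : 1 < p) (hq : 0 < q)
    (hlam : ∀ s : ℝ, lam (Iic s) < ∞) (hμ : ∀ y : ℝ, μ (Ici y) < ∞)
    (hBm : ∀ y, MeasurableSet (B y)) (hBl : ∀ y, IsLowerSet (B y)) (hmono : Monotone B)
    (hIic : ∀ y, B y ⊆ Iic y) {b : ℝ → ℝ≥0∞}
    (hb : b =ᵐ[volume.restrict (Ioi 0)] rearrangement μ fun y => lam (B y)) (C : ℝ≥0∞) :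
    AbstractHardyIneq lam μ B p q C ↔ NormalFormIneq b p q C := by
  have hp0 : 0 < p := by linarith
  have := sigmaFinite_of_measure_Iic_lt_top hlam
  obtain ⟨T, φ, hT, hT0, hlow, hφmono, hφ, hmap⟩ := exists_monotoneOn_map_volume_eq hlam
  -- Since `λ (Iic y) → 0` at `-∞`, each superlevel set lies in a right ray, which has finite
  -- `μ`-measure.
  have hfin : ∀ c : ℝ≥0∞, 0 < c → μ {y | c < lam (B y)} < ∞ := by
    intro c hc
    obtain ⟨y₀, hy₀⟩ := exists_measure_Iic_lt hlam hc
    have hsub : {y | c < lam (B y)} ⊆ Ici y₀ := fun y hy => le_of_not_gt fun hlt =>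
      lt_asymm hy (((measure_mono (hIic y)).trans
        (measure_mono (Iic_subset_Iic.2 hlt.le))).trans_lt hy₀)
    exact (measure_mono hsub).trans_lt (hμ y₀)
  have hlhs : ∀ f : ℝ → ℝ≥0∞,
      ∫⁻ y, (∫⁻ t in φ ⁻¹' B y, f t ∂(volume.restrict T)) ^ q ∂μ =
        ∫⁻ x in Ioi (0 : ℝ), (normalFormOp b f x) ^ q := by
    intro f
    -- The inner integral is a function of `λ(B y)` alone, measurable because monotone, and zero at
    -- `0` because `q > 0`.
    have hG : Monotone fun u : ℝ≥0∞ =>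
        (∫⁻ t in {t : ℝ | 0 < t ∧ ENNReal.ofReal t < u}, f t) ^ q := fun u v huv =>
      ENNReal.rpow_le_rpow (lintegral_mono_set fun t ht => ⟨ht.1, ht.2.trans_le huv⟩) hq.le
    simp only [fun y => setLIntegral_preimage_eq hT0 hlow hφmono hφ hmap (hBm y) (hBl y) f]
    refine lintegral_comp_eq_of_ae_eq_rearrangement
      (Monotone.measurable fun y z h => measure_mono (hmono h)) hfin hb hG.measurable ?_
    simp [hq]
  rw [abstractHardyIneq_iff_of_measurable, normalFormIneq_iff_of_measurable]
  constructor
  · intro H f hf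
    obtain ⟨g, hg, hgB, hgp⟩ := exists_lintegral_rpow_le_of_map hφ hmap hp hf
    rw [← hlhs]
    simp only [← fun y => hgB _ (hBm y)]
    refine (H g hg).trans ?_
    -- The part of `f` outside `T` only enlarges the right-hand side.
    have hle := hgp.trans (lintegral_mono_set hT0)
    gcongr C * ?_ ^ (1 / p)
  · intro H g hg
    have h1 : ∀ y, ∫⁻ s in B y, g s ∂lam =
        ∫⁻ t in φ ⁻¹' B y, T.indicator (g ∘ φ) t ∂(volume.restrict T) := by
      intro y
      rw [← hmap, setLIntegral_map (hBm y) hg hφ]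
      exact lintegral_congr_ae (ae_restrict_of_ae ((ae_restrict_mem hT).mono fun t ht => by
        simp only [indicator_of_mem ht, Function.comp_apply]))
    have h2 : ∫⁻ t in Ioi (0 : ℝ), T.indicator (g ∘ φ) t ^ p = ∫⁻ s, g s ^ p ∂lam := by
      have : (fun t => T.indicator (g ∘ φ) t ^ p) = T.indicator fun t => g (φ t) ^ p := by
        ext t
        by_cases ht : t ∈ T <;> simp [ht, hp0]
      rw [this, lintegral_indicator hT, Measure.restrict_restrict hT, inter_eq_left.2 hT0, ← hmap,
        lintegral_map (hg.pow_const p) hφ]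
    simp only [h1]
    rw [hlhs, ← h2]
    exact H _ ((hg.comp hφ).indicator hT)

theorem hardy_normalForm_of_ae_eq {p q : ℝ} (hp : 1 < p) (hq : 0 < q)
    (hlam : ∀ s : ℝ, lam (Iic s) < ∞) (hμ : ∀ y : ℝ, μ (Ici y) < ∞)
    (hBm : ∀ y, MeasurableSet (B y)) (hBl : ∀ y, IsLowerSet (B y)) (hmono : Monotone B)
    (hIio : ∀ y, Iio y ⊆ B y) (hIic : ∀ y, B y ⊆ Iic y) {b : ℝ → ℝ≥0∞} (hanti : Antitone b)
    (hb : b =ᵐ[volume.restrict (Ioi 0)] rearrangement μ fun y => lam (B y)) :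
    IsNormalFormParameter lam μ B b ∧
      (∀ C : ℝ≥0∞, AbstractHardyIneq lam μ B p q C ↔ NormalFormIneq b p q C) ∧
      abstractHardyNorm lam μ B p q = normalFormNorm b p q := by
  have hiff := abstractHardyIneq_iff_normalFormIneq hp hq hlam hμ hBm hBl hmono hIic hb
  refine ⟨⟨isCoreMap_of_Iio_subset hlam hμ hBm hmono hIio hIic, hanti.antitoneOn _, hb⟩, hiff, ?_⟩
  simp only [abstractHardyNorm, normalFormNorm, hiff]

end Line

theorem theorem2p3 (p q : ℝ) (hp : 1 < p) (hq : 0 < q) (lam μ : Measure ℝ)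
    (hlam : ∀ s : ℝ, lam (Iic s) < ∞) (hμ : ∀ y : ℝ, μ (Ici y) < ∞)
    (M : ℝ → ℝ≥0∞) (hM : ∀ y : ℝ, μ (Ioi y) ≤ M y ∧ M y ≤ μ (Ici y)) :
    (IsNormalFormParameter lam μ (fun y : ℝ => Iio y)
        (fun x => cumulLt lam (lineInverse M x)) ∧
      (∀ C : ℝ≥0∞, AbstractHardyIneq lam μ (fun y : ℝ => Iio y) p q C ↔
        NormalFormIneq (fun x => cumulLt lam (lineInverse M x)) p q C) ∧
      abstractHardyNorm lam μ (fun y : ℝ => Iio y) p q =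
        normalFormNorm (fun x => cumulLt lam (lineInverse M x)) p q) ∧
    (IsNormalFormParameter lam μ (fun y : ℝ => Iic y)
        (fun x => cumulLe lam (lineInverse M x)) ∧
      (∀ C : ℝ≥0∞, AbstractHardyIneq lam μ (fun y : ℝ => Iic y) p q C ↔
        NormalFormIneq (fun x => cumulLe lam (lineInverse M x)) p q C) ∧
      abstractHardyNorm lam μ (fun y : ℝ => Iic y) p q =
        normalFormNorm (fun x => cumulLe lam (lineInverse M x)) p q) := by
  exact ⟨hardy_normalForm_of_ae_eq hp hq hlam hμ (fun _ => measurableSet_Iio) isLowerSet_Iio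
      (fun _ _ h => Iio_subset_Iio h) (fun _ => subset_rfl) (fun _ => Iio_subset_Iic_self)
      ((monotone_cumulLt lam).comp_antitone (antitone_lineInverse M))
      (cumulLt_lineInverse_ae_eq hM),
    hardy_normalForm_of_ae_eq hp hq hlam hμ (fun _ => measurableSet_Iic) isLowerSet_Iic
      (fun _ _ h => Iic_subset_Iic.2 h) (fun _ => Iio_subset_Iic_self) (fun _ => subset_rfl)
      ((monotone_cumulLe lam).comp_antitone (antitone_lineInverse M))
      (cumulLe_lineInverse_ae_eq hμ hM)⟩
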